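/- Let $(M,g)$ be a compact connected Riemannian manifold (without boundary), and let $\mathcal E\to M$ be a smooth real vector bundle of finite rank with a smooth fibre metric $\langle\,,\rangle$ and a smooth connection $\nabla$ compatible with $\langle\,,\rangle$. For $p,q\in\mathbb R$ the vertical $(p,q)$-energy of a smooth section $\sigma$ of $\mathcal E$ is $$E^v_{p,q}(\sigma)=\frac12\int_M\frac{1}{(1+|\sigma|^2)^p}\sum_i\Bigl(\langle\nabla_{E_i}\sigma,\nabla_{E_i}\sigma\rangle+q\,\langle\nabla_{E_i}\sigma,\sigma\rangle^2\Bigr)\operatorname{vol}(g),$$ where $\{E_i\}$ is a local orthonormal tangent frame, and $\sigma$ is called $(p,q)$-harmonic if $\left.\frac{d}{dt}\right|_{t=0}E^v_{p,q}(\sigma_t)=0$ for every smooth variation $\sigma_t$, $t\in\mathbb R$, of $\sigma=\sigma_0$ through sections of $\mathcal E$. For $\nu>0$ define $\varrho_\nu\colon[-4,\infty)\to\mathbb R$ by $$\varrho_\nu(p)=\begin{cases}-1-p,&-4\le p\le-1,\\ 0,&-1\le p\le 2,\\ \nu(2-p)/2,&p\ge2.\end{cases}$$ Corollary 4.9. Let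 $\sigma$ be a smooth section of $\mathcal E$ whose length $|\sigma|$ is not constant. Then for each $p\in\mathbb R$ there exists at most one $q\in\mathbb R$ such that $\sigma$ is $(p,q)$-harmonic. Moreover, suppose that $\sigma$ is $(p,q)$-harmonic and that $\nu$ is a real number such that either $\nu>0$ and $-4\le p\le1$, or $\nu\ge1$, $p>1$ and $\|\sigma\|_\infty^2\le\dfrac1{\nu(p-1)}$, where $\|\sigma\|_\infty=\sup_{x\in M}|\sigma(x)|$. Then $q<\varrho_\nu(p)$. -/

import Mathlib

open Bundle MeasureTheory
open scoped Manifold ContDiff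

noncomputable section

namespace PQHarmonic

section Volume

variable {n : ℕ} {M : Type*} [TopologicalSpace M] [ChartedSpace (EuclideanSpace ℝ (Fin n)) M]
  [RiemannianBundle (fun x : M ↦ TangentSpace (𝓡 n) x)]

/-- `√ det (g_ij)` at the point `y` of the range of the preferred chart at `c`, where
`g_ij = g(∂_i, ∂_j)` and `∂_i` is the `i`-th coordinate vector field of that chart, i.e. the image
of the `i`-th standard basis vector under the differential of the inverse chart. -/
def volumeDensity (c : M) (y : EuclideanSpace ℝ (Fin n)) : ℝ :=
  Real.sqrt (Matrix.det (Matrix.of fun i j : Fin n ↦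
    inner ℝ
      (mfderiv (𝓡 n) (𝓡 n) (extChartAt (𝓡 n) c).symm y (EuclideanSpace.single i (1 : ℝ)))
      (mfderiv (𝓡 n) (𝓡 n) (extChartAt (𝓡 n) c).symm y (EuclideanSpace.single j (1 : ℝ)))))

variable [MeasurableSpace M]

/-- The measure `√ det (g_ij) dx¹ ⋯ dxⁿ` on the domain of the preferred chart at `c`, extended by
zero to `M`. -/
def chartVolume (c : M) : Measure M :=
  (((volume : Measure (EuclideanSpace ℝ (Fin n))).restrict
      (extChartAt (𝓡 n) c).target).withDensity
        fun y ↦ ENNReal.ofReal (volumeDensity c y)).map (extChartAt (𝓡 n) c).symm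

variable (n M) in
/-- The Riemannian measure `vol(g)`. By the change of variables formula the measures
`√ det (g_ij) dx¹ ⋯ dxⁿ` of two charts agree on the overlap of the charts; the Riemannian measure
is the measure which restricts to each of them on the domain of the chart. When `M` is covered by
countably many charts, this is the least measure dominating all of them. -/
def riemannianVolume : Measure M := ⨆ c : M, chartVolume (n := n) c

end Volume

section Energy

variable {n : ℕ} {M : Type*} [TopologicalSpace M] [ChartedSpace (EuclideanSpace ℝ (Fin n)) M]
  [RiemannianBundle (fun x : M ↦ TangentSpace (𝓡 n) x)]
  {F : Type*} [NormedAddCommGroup F] [NormedSpace ℝ F]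
  {E : M → Type*} [TopologicalSpace (TotalSpace F E)]
  [∀ x, NormedAddCommGroup (E x)] [∀ x, InnerProductSpace ℝ (E x)] [FiberBundle F E]

/-- The metric `h_{p,q}` on vertical vectors: the vertical space of the total space at a point `e`
is identified with the fibre `W` through `e` (this is what the connection map does), and there
`h_{p,q}(a, b) = w(e)^p (⟨a, b⟩ + q ⟨a, e⟩ ⟨b, e⟩)` with `w(e) = 1 / (1 + |e|²)`. -/
def verticalMetric {W : Type*} [NormedAddCommGroup W] [InnerProductSpace ℝ W]
    (p q : ℝ) (e a b : W) : ℝ :=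
  (1 / (1 + ‖e‖ ^ 2)) ^ p * (inner ℝ a b + q * inner ℝ a e * inner ℝ b e)

/-- `|d^v σ|²` at `x` with respect to `h_{p,q}`: the sum of
`h_{p,q}(d^v σ(E_i), d^v σ(E_i))` over an orthonormal basis `E_i` of the tangent space at `x`.
The vertical component of `dσ(X)` corresponds to `∇_X σ`, which is `cov σ x X` in Lean. -/
def verticalNormSq (cov : CovariantDerivative (𝓡 n) F E) (p q : ℝ) (σ : Π x : M, E x) (x : M) : ℝ :=
  haveI : FiniteDimensional ℝ (TangentSpace (𝓡 n) x) :=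
    inferInstanceAs (FiniteDimensional ℝ (EuclideanSpace ℝ (Fin n)))
  ∑ i, verticalMetric p q (σ x)
    (cov σ x (stdOrthonormalBasis ℝ (TangentSpace (𝓡 n) x) i))
    (cov σ x (stdOrthonormalBasis ℝ (TangentSpace (𝓡 n) x) i))

/-- The vertical `(p,q)`-energy `½ ∫_M |d^v σ|² vol(g)` (for compact `M`). -/
def verticalEnergy [MeasurableSpace M] (cov : CovariantDerivative (𝓡 n) F E) (p q : ℝ)
    (σ : Π x : M, E x) : ℝ :=
  1 / 2 * ∫ x, verticalNormSq cov p q σ x ∂(riemannianVolume n M)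

/-- `τ t`, `t ∈ ℝ`, is a smooth variation of `σ` through sections: `(x, t) ↦ τ t x` is a smooth
map from `M × ℝ` to the total space of the bundle, and `τ 0 = σ`. -/
def IsSmoothVariation (n : ℕ) {M : Type*} [TopologicalSpace M]
    [ChartedSpace (EuclideanSpace ℝ (Fin n)) M]
    (F : Type*) [NormedAddCommGroup F] [NormedSpace ℝ F]
    {E : M → Type*} [TopologicalSpace (TotalSpace F E)]
    [∀ x, NormedAddCommGroup (E x)] [FiberBundle F E]
    (σ : Π x : M, E x) (τ : ℝ → Π x : M, E x) : Prop :=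
  ContMDiff ((𝓡 n).prod 𝓘(ℝ, ℝ)) ((𝓡 n).prod 𝓘(ℝ, F)) ∞
    (fun z : M × ℝ ↦ (⟨z.1, τ z.2 z.1⟩ : TotalSpace F E)) ∧ τ 0 = σ

/-- `σ` is a `(p,q)`-harmonic section (of a bundle over a compact manifold): it is a smooth
section which is stationary for the vertical `(p,q)`-energy with respect to smooth variations
through sections. -/
def IsHarmonicSection [MeasurableSpace M] (cov : CovariantDerivative (𝓡 n) F E) (p q : ℝ)
    (σ : Π x : M, E x) : Prop :=
  ContMDiff (𝓡 n) ((𝓡 n).prod 𝓘(ℝ, F)) ∞ (fun x ↦ (⟨x, σ x⟩ : TotalSpace F E)) ∧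
    ∀ τ : ℝ → Π x : M, E x, IsSmoothVariation n F σ τ →
      HasDerivAt (fun t ↦ verticalEnergy cov p q (τ t)) 0 0

end Energy

/-- The piecewise-linear cut-off function `ϱ_ν` on `[-4, ∞)` (its values below `-4` play no
role). -/
def cutoff (ν p : ℝ) : ℝ :=
  if p ≤ -1 then -1 - p else if p ≤ 2 then 0 else ν * (2 - p) / 2

end PQHarmonic

end

/-! Write r = |σ|², A = |∇σ|², B = |⟨∇σ, σ⟩|². The only variations needed rescale σ: σ_t = (1 + t (1
+ r)^((p-1)/2)) σ. Differentiating the energy at t = 0 gives ∫ w G = 0 with w > 0 and G = A (1 -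
(p-1) r) + B (p - 1 + q (2 + r)); this is `integral_firstVariationDensity_eq_zero`. The exponent
(p-1)/2 makes the coefficient of q in G equal to B (2 + r), which is nonnegative for every p.

Metric compatibility gives d|σ|² = 2⟨∇σ, σ⟩, so on a connected M a section of non-constant length
has B ≠ 0 somewhere (`exists_covInnerSq_ne_zero`). Subtracting the identities for two distinct
values of q would give ∫ w B (2 + r) = 0, hence B = 0 everywhere: this is uniqueness. If q were at
least the cut-off, then `firstVariation_nonneg`, which rests on the Cauchy–Schwarz bound B ≤ r A,
would give G ≥ 0 with equality only where B = 0, and the vanishing integral would again force B = 0.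

The analytic support is that the Riemannian measure is finite and positive on nonempty open sets,
that A and B are continuous although they are defined through pointwise chosen orthonormal bases,
and that one may differentiate under the integral. -/

noncomputable section

set_option linter.unusedSectionVars false

namespace PQHarmonic

/-! ### Traces of bilinear forms through an inverse Gram matrix. -/

section LinearAlgebra

variable {V : Type*} [NormedAddCommGroup V] [InnerProductSpace ℝ V]
variable {ι κ : Type*} [Fintype ι] [DecidableEq ι] [Fintype κ] [DecidableEq κ]

omit [DecidableEq ι] in
theorem gram_toMatrix (b : Module.Basis ι ℝ V) (e : OrthonormalBasis κ ℝ V) :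
    (b.toMatrix e).transpose * (Matrix.gram ℝ b) * b.toMatrix e = 1 := by
  ext i j
  have h : ∀ k, e k = ∑ l, b.toMatrix e l k • b l := fun k ↦ by
    simp [Module.Basis.toMatrix_apply, b.sum_repr]
  rw [Matrix.one_apply, ← e.inner_eq_ite, h i, h j, sum_inner]
  simp only [inner_sum, inner_smul_left, inner_smul_right, Matrix.mul_apply, Matrix.gram_apply,
    Matrix.transpose_apply, Finset.sum_mul]
  rw [Finset.sum_comm]
  refine Finset.sum_congr rfl fun x _ ↦ Finset.sum_congr rfl fun y _ ↦ ?_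
  simp
  ring

/-- Both sides are the metric trace of `T`. The right side uses an arbitrary basis, so it can be
evaluated in a smooth local frame. -/
theorem sum_orthonormalBasis_eq (b : Module.Basis ι ℝ V) (e : OrthonormalBasis κ ℝ V)
    (T : V →ₗ[ℝ] V →ₗ[ℝ] ℝ) :
    ∑ i, T (e i) (e i) = ∑ j, ∑ k, (Matrix.gram ℝ b)⁻¹ j k * T (b j) (b k) := by
  have hc : Fintype.card κ = Fintype.card ι := by
    rw [← Module.finrank_eq_card_basis b, ← Module.finrank_eq_card_basis e.toBasis]
  have h : ∀ k, e k = ∑ l, b.toMatrix e l k • b l := fun k ↦ by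
    simp [Module.Basis.toMatrix_apply, b.sum_repr]
  have hP : (Matrix.gram ℝ b)⁻¹ = b.toMatrix e * (b.toMatrix e).transpose := by
    apply Matrix.inv_eq_right_inv
    have h1 := gram_toMatrix b e
    -- With P the change of basis and G the Gram matrix, PᵀGP = 1. The index types have equal
    -- cardinality, so a one-sided inverse is two-sided and G P Pᵀ = 1.
    rw [Matrix.mul_assoc, Matrix.mul_eq_one_comm_of_card_eq _ _ _ hc, Matrix.mul_assoc] at h1
    rw [← Matrix.mul_assoc]
    simpa [Matrix.mul_assoc] using h1
  have h2 : ∀ i, T (e i) (e i) = ∑ j, ∑ k, b.toMatrix e j i * b.toMatrix e k i * T (b j) (b k) := by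
    intro i
    conv_lhs => rw [h i]
    simp only [map_sum, LinearMap.sum_apply, map_smul, LinearMap.smul_apply, smul_eq_mul,
      Finset.mul_sum]
    rw [Finset.sum_comm]
    exact Finset.sum_congr rfl fun _ _ ↦ Finset.sum_congr rfl fun _ _ ↦ by ring
  simp_rw [h2, hP, Matrix.mul_apply, Finset.sum_mul, Matrix.transpose_apply]
  rw [Finset.sum_comm]
  refine Finset.sum_congr rfl fun x _ ↦ ?_
  rw [Finset.sum_comm]

end LinearAlgebra

/-! ### Continuity of metric traces. -/

section Trace

variable {n : ℕ} {M : Type*} [TopologicalSpace M] [ChartedSpace (EuclideanSpace ℝ (Fin n)) M]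
  [IsManifold (𝓡 n) ∞ M]
  [RiemannianBundle (fun x : M ↦ TangentSpace (𝓡 n) x)]
  [IsContMDiffRiemannianBundle (𝓡 n) ∞ (EuclideanSpace ℝ (Fin n))
      (fun x : M ↦ TangentSpace (𝓡 n) x)]

/-- The bases `e x` need not vary continuously. Near each point the trace is rewritten in a smooth
local frame, whose Gram matrix and its inverse are continuous there. -/
theorem continuous_trace {κ : M → Type*} [∀ x, Fintype (κ x)]
    (e : Π x : M, OrthonormalBasis (κ x) ℝ (TangentSpace (𝓡 n) x))
    (T : Π x : M, TangentSpace (𝓡 n) x →ₗ[ℝ] TangentSpace (𝓡 n) x →ₗ[ℝ] ℝ)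
    (hT : ∀ (x : M) (X Y : Π y : M, TangentSpace (𝓡 n) y),
      ContMDiffAt (𝓡 n) ((𝓡 n).prod 𝓘(ℝ, EuclideanSpace ℝ (Fin n))) ∞
        (fun y ↦ (⟨y, X y⟩ : TangentBundle (𝓡 n) M)) x →
      ContMDiffAt (𝓡 n) ((𝓡 n).prod 𝓘(ℝ, EuclideanSpace ℝ (Fin n))) ∞
        (fun y ↦ (⟨y, Y y⟩ : TangentBundle (𝓡 n) M)) x →
      ContinuousAt (fun y ↦ T y (X y) (Y y)) x) :
    Continuous fun x ↦ ∑ i, T x (e x i) (e x i) := by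
  classical
  rw [continuous_iff_continuousAt]
  intro x₀
  let t := trivializationAt (EuclideanSpace ℝ (Fin n)) (TangentSpace (𝓡 n) : M → Type _) x₀
  let b := (EuclideanSpace.basisFun (Fin n) ℝ).toBasis
  have hx₀ : x₀ ∈ t.baseSet := FiberBundle.mem_baseSet_trivializationAt' x₀
  let s := t.localFrame b
  have hs : ∀ i, ContMDiffAt (𝓡 n) ((𝓡 n).prod 𝓘(ℝ, EuclideanSpace ℝ (Fin n))) ∞
        (fun y ↦ (⟨y, s i y⟩ : TangentBundle (𝓡 n) M)) x₀ := fun i ↦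
    contMDiffAt_localFrame_of_mem ∞ t b i hx₀
  have hev : ∀ᶠ x in nhds x₀, x ∈ t.baseSet := t.open_baseSet.mem_nhds hx₀
  have hG : ContinuousAt (fun x ↦ Matrix.gram ℝ fun i ↦ s i x) x₀ := by
    refine continuousAt_pi.2 fun i ↦ continuousAt_pi.2 fun j ↦ ?_
    exact ((hs i).inner_bundle (hs j)).continuousAt
  have hli : LinearIndependent ℝ fun i ↦ s i x₀ :=
    (t.isLocalFrameOn_localFrame_baseSet (𝓡 n) ∞ b).linearIndependent hx₀
  have hinv : ContinuousAt (fun x ↦ (Matrix.gram ℝ fun i ↦ s i x)⁻¹) x₀ := by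
    have hd : IsUnit (Matrix.gram ℝ fun i ↦ s i x₀).det :=
      (Matrix.det_gram_ne_zero_iff_linearIndependent.2 hli).isUnit
    have h1 : ContinuousAt (fun x ↦ (Matrix.gram ℝ fun i ↦ s i x).det) x₀ :=
      (Continuous.matrix_det continuous_id).continuousAt.comp hG
    have h2 : ContinuousAt (fun x ↦ (Matrix.gram ℝ fun i ↦ s i x).adjugate) x₀ :=
      (Continuous.matrix_adjugate continuous_id).continuousAt.comp hG
    simp only [Matrix.inv_def, Ring.inverse_eq_inv']
    exact (h1.inv₀ hd.ne_zero).smul h2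
  refine ContinuousAt.congr (f := fun x ↦ ∑ j, ∑ k, (Matrix.gram ℝ fun i ↦ s i x)⁻¹ j k *
    T x (s j x) (s k x)) ?_ ?_
  · refine tendsto_finsetSum _ fun j _ ↦ tendsto_finsetSum _ fun k _ ↦ ?_
    exact (continuousAt_pi.1 (continuousAt_pi.1 hinv j) k).mul (hT x₀ _ _ (hs j) (hs k))
  · filter_upwards [hev] with x hx
    have h := sum_orthonormalBasis_eq (t.basisAt b hx) (e x) (T x)
    have hb : ⇑(t.basisAt b hx) = fun i ↦ s i x := by
      ext1 i
      simp [s, hx]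
    rw [h, hb]

end Trace

/-! ### Gram determinants under a linear change of variables. -/

section GramDeterminant

variable {V : Type*} [NormedAddCommGroup V] [InnerProductSpace ℝ V]

theorem gram_sum_smul {ι κ : Type*} [Fintype ι] (v : ι → V) (J : Matrix ι κ ℝ) :
    Matrix.gram ℝ (fun i ↦ ∑ k, J k i • v k) = J.transpose * Matrix.gram ℝ v * J := by
  ext i j
  simp only [Matrix.gram_apply, Matrix.mul_apply, sum_inner, inner_sum, inner_smul_left,
    inner_smul_right, Finset.sum_mul, Matrix.transpose_apply]
  refine Finset.sum_congr rfl fun x _ ↦ ?_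
  rw [Finset.mul_sum]
  refine Finset.sum_congr rfl fun y _ ↦ ?_
  simp
  ring

/-- Precomposition with `D` turns the Gram matrix G into JᵀGJ, so its determinant gains the factor
(det J)². This is the transformation law of the volume density. -/
theorem sqrt_det_gram_comp {n : ℕ} (L : EuclideanSpace ℝ (Fin n) →ₗ[ℝ] V)
    (D : EuclideanSpace ℝ (Fin n) →L[ℝ] EuclideanSpace ℝ (Fin n)) :
    Real.sqrt (Matrix.gram ℝ fun i ↦ L (D (EuclideanSpace.single i 1))).det =
      |D.det| * Real.sqrt (Matrix.gram ℝ fun i ↦ L (EuclideanSpace.single i 1)).det := by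
  let b := (EuclideanSpace.basisFun (Fin n) ℝ).toBasis
  let J := LinearMap.toMatrix b b (D : EuclideanSpace ℝ (Fin n) →ₗ[ℝ] EuclideanSpace ℝ (Fin n))
  have hJ : J.det = D.det := LinearMap.det_toMatrix b _
  have h : (fun i ↦ L (D (EuclideanSpace.single i 1))) =
      fun i ↦ ∑ k, J k i • L (EuclideanSpace.single k 1) := by
    ext1 i
    have h1 : D (EuclideanSpace.single i 1) = ∑ k, J k i • (EuclideanSpace.single k (1 : ℝ)) := by
      have h2 := (b.sum_repr (D (b i))).symm
      simpa [b, J, LinearMap.toMatrix_apply] using h2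
    rw [h1, map_sum]
    simp
  rw [h, gram_sum_smul, Matrix.det_mul, Matrix.det_mul, Matrix.det_transpose, hJ,
    mul_comm, ← mul_assoc, Real.sqrt_mul (mul_self_nonneg _), Real.sqrt_mul_self_eq_abs]

end GramDeterminant

/-! ### The volume density in a chart: positivity, change of chart, continuity. -/

section Volume

variable {n : ℕ} {M : Type*} [TopologicalSpace M] [ChartedSpace (EuclideanSpace ℝ (Fin n)) M]
  [IsManifold (𝓡 n) ∞ M]
  [RiemannianBundle (fun x : M ↦ TangentSpace (𝓡 n) x)]

omit [RiemannianBundle (fun x : M ↦ TangentSpace (𝓡 n) x)] in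
theorem mdifferentiableAt_extChartAt_symm {c : M} {y : EuclideanSpace ℝ (Fin n)}
    (hy : y ∈ (extChartAt (𝓡 n) c).target) :
    MDifferentiableAt (𝓡 n) (𝓡 n) (extChartAt (𝓡 n) c).symm y :=
  ((contMDiffOn_extChartAt_symm (n := ∞) c).contMDiffAt
    ((isOpen_extChartAt_target c).mem_nhds hy)).mdifferentiableAt (by simp)

theorem volumeDensity_pos {c : M} {y : EuclideanSpace ℝ (Fin n)}
    (hy : y ∈ (extChartAt (𝓡 n) c).target) : 0 < volumeDensity c y := by
  have hinv : Function.Injective (mfderiv (𝓡 n) (𝓡 n) (extChartAt (𝓡 n) c).symm y) := by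
    have h := isInvertible_mfderivWithin_extChartAt_symm (I := 𝓡 n) hy
    rw [ModelWithCorners.range_eq_univ, mfderivWithin_univ] at h
    exact h.injective
  have hli : LinearIndependent ℝ fun i : Fin n ↦
      mfderiv (𝓡 n) (𝓡 n) (extChartAt (𝓡 n) c).symm y (EuclideanSpace.single i (1 : ℝ)) := by
    have hb := (EuclideanSpace.basisFun (Fin n) ℝ).toBasis.linearIndependent
    let L : EuclideanSpace ℝ (Fin n) →ₗ[ℝ] TangentSpace (𝓡 n) ((extChartAt (𝓡 n) c).symm y) :=
      (mfderiv (𝓡 n) (𝓡 n) (extChartAt (𝓡 n) c).symm y).toLinearMap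
    have h1 := hb.map' L (LinearMap.ker_eq_bot.2 (show Function.Injective L from hinv))
    convert! h1 using 1
    ext1 i
    exact congrArg L (by simp)
  exact Real.sqrt_pos.2 (Matrix.posDef_gram_of_linearIndependent hli).det_pos

/-- Near `y` the inverse chart at `c` is the inverse chart at `c'` after the transition map, so the
chain rule and `sqrt_det_gram_comp` apply. -/
theorem volumeDensity_eq {c c' : M} {y : EuclideanSpace ℝ (Fin n)}
    (hy : y ∈ (extChartAt (𝓡 n) c).target)
    (hy' : (extChartAt (𝓡 n) c).symm y ∈ (extChartAt (𝓡 n) c').source) :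
    DifferentiableAt ℝ (extChartAt (𝓡 n) c' ∘ (extChartAt (𝓡 n) c).symm) y ∧
    volumeDensity c y =
      |(fderiv ℝ (extChartAt (𝓡 n) c' ∘ (extChartAt (𝓡 n) c).symm) y).det| *
        volumeDensity c' (extChartAt (𝓡 n) c' ((extChartAt (𝓡 n) c).symm y)) := by
  set f := extChartAt (𝓡 n) c' ∘ (extChartAt (𝓡 n) c).symm with hf
  have hd := mdifferentiableAt_extChartAt_symm hy
  have hd' : MDifferentiableAt (𝓡 n) (𝓡 n) (extChartAt (𝓡 n) c')
      ((extChartAt (𝓡 n) c).symm y) := mdifferentiableAt_extChartAt (by simpa using hy')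
  have hfd : MDifferentiableAt (𝓡 n) (𝓡 n) f y := hd'.comp y hd
  refine ⟨hfd.differentiableAt, ?_⟩
  have hfy : f y ∈ (extChartAt (𝓡 n) c').target := (extChartAt (𝓡 n) c').map_source hy'
  have hs := mdifferentiableAt_extChartAt_symm hfy
  have heq : (extChartAt (𝓡 n) c).symm =ᶠ[nhds y] (extChartAt (𝓡 n) c').symm ∘ f := by
    have h1 : ∀ᶠ z in nhds y, (extChartAt (𝓡 n) c).symm z ∈ (extChartAt (𝓡 n) c').source :=
      hd.continuousAt.eventually ((isOpen_extChartAt_source c').mem_nhds hy')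
    filter_upwards [h1] with z hz
    simp only [f, Function.comp_apply]
    exact ((extChartAt (𝓡 n) c').left_inv hz).symm
  have hm : ∀ v : EuclideanSpace ℝ (Fin n),
      (mfderiv (𝓡 n) (𝓡 n) (extChartAt (𝓡 n) c).symm y v : EuclideanSpace ℝ (Fin n)) =
      mfderiv (𝓡 n) (𝓡 n) (extChartAt (𝓡 n) c').symm (f y) (fderiv ℝ f y v) := by
    intro v
    have h1 := heq.mfderiv_eq (I := 𝓡 n) (I' := 𝓡 n)
    rw [mfderiv_comp y hs hfd] at h1
    have h2 := congrArg (fun L : EuclideanSpace ℝ (Fin n) →L[ℝ] EuclideanSpace ℝ (Fin n) ↦ L v) h1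
    rw [← mfderiv_eq_fderiv]
    exact h2
  have hxx : (extChartAt (𝓡 n) c).symm y = (extChartAt (𝓡 n) c').symm (f y) := heq.eq_of_nhds
  -- The two base points are only propositionally equal, so the inner products must be compared by
  -- substitution.
  have key : ∀ (x x' : M), x = x' → ∀ v w : EuclideanSpace ℝ (Fin n),
      inner (E := TangentSpace (𝓡 n) x) ℝ v w = inner (E := TangentSpace (𝓡 n) x') ℝ v w := by
    rintro x _ rfl v w
    rfl
  have hD := sqrt_det_gram_comp (V := TangentSpace (𝓡 n) ((extChartAt (𝓡 n) c').symm (f y)))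
    (mfderiv (𝓡 n) (𝓡 n) (extChartAt (𝓡 n) c').symm (f y)).toLinearMap (fderiv ℝ f y)
  refine Eq.trans ?_ hD
  unfold volumeDensity
  congr 2
  ext i j
  refine (key _ _ hxx
    (mfderiv (𝓡 n) (𝓡 n) (extChartAt (𝓡 n) c).symm y (EuclideanSpace.single i 1))
    (mfderiv (𝓡 n) (𝓡 n) (extChartAt (𝓡 n) c).symm y (EuclideanSpace.single j 1))).trans ?_
  rw [Matrix.gram_apply]
  congr 1
  · exact hm _
  · exact hm _

variable [IsContMDiffRiemannianBundle (𝓡 n) ∞ (EuclideanSpace ℝ (Fin n))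
      (fun x : M ↦ TangentSpace (𝓡 n) x)]

/-- The coordinate fields are images of constant fields under the tangent map of the inverse chart,
hence continuous into the tangent bundle, and the metric is continuous on it. -/
theorem continuousOn_volumeDensity (c : M) :
    ContinuousOn (volumeDensity c) (extChartAt (𝓡 n) c).target := by
  have hv : ∀ v : EuclideanSpace ℝ (Fin n), ContinuousOn
      (fun y : EuclideanSpace ℝ (Fin n) ↦ (⟨(extChartAt (𝓡 n) c).symm y,
        mfderiv (𝓡 n) (𝓡 n) (extChartAt (𝓡 n) c).symm y v⟩ : TangentBundle (𝓡 n) M))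
      (extChartAt (𝓡 n) c).target := by
    intro v
    have ho := isOpen_extChartAt_target (I := 𝓡 n) c
    have h := (contMDiffOn_extChartAt_symm (I := 𝓡 n) (n := ∞) c).continuousOn_tangentMapWithin
      (by simp) ho.uniqueMDiffOn
    have h1 : Continuous fun y : EuclideanSpace ℝ (Fin n) ↦
        (⟨y, v⟩ : TangentBundle (𝓡 n) (EuclideanSpace ℝ (Fin n))) := by
      have := (tangentBundleModelSpaceHomeomorph (𝓡 n)).symm.continuous.comp
        (Continuous.prodMk continuous_id (continuous_const (y := v)))
      exact this
    refine (h.comp h1.continuousOn fun y hy ↦ hy).congr fun y hy ↦ ?_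
    simp only [Function.comp_apply, tangentMapWithin]
    rw [mfderivWithin_of_isOpen ho hy]
  have : IsContinuousRiemannianBundle (EuclideanSpace ℝ (Fin n))
      (TangentSpace (𝓡 n) : M → Type _) := by
    obtain ⟨g, hg, hgi⟩ := IsContMDiffRiemannianBundle.exists_contMDiff (IB := 𝓡 n) (n := ∞)
      (F := EuclideanSpace ℝ (Fin n)) (E := (TangentSpace (𝓡 n) : M → Type _))
    exact ⟨g, hg.continuous, hgi⟩
  refine Real.continuous_sqrt.comp_continuousOn ?_
  refine (Continuous.matrix_det continuous_id).comp_continuousOn ?_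
  refine continuousOn_pi.2 fun i ↦ continuousOn_pi.2 fun j ↦ ?_
  exact (hv _).inner_bundle (hv _)

end Volume

/-! ### The Riemannian measure: independence of charts, positivity, finiteness. -/

section ChartVolume

variable {n : ℕ} {M : Type*} [TopologicalSpace M] [ChartedSpace (EuclideanSpace ℝ (Fin n)) M]
  [IsManifold (𝓡 n) ∞ M]
  [RiemannianBundle (fun x : M ↦ TangentSpace (𝓡 n) x)] [MeasurableSpace M] [BorelSpace M]

omit [IsManifold (𝓡 n) ∞ M] in
theorem chartVolume_apply (c : M) {S : Set M} (hS : MeasurableSet S) :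
    chartVolume (n := n) c S =
      ∫⁻ y in (extChartAt (𝓡 n) c).symm ⁻¹' S ∩ (extChartAt (𝓡 n) c).target,
        ENNReal.ofReal (volumeDensity c y) := by
  have ht : MeasurableSet (extChartAt (𝓡 n) c).target := (isOpen_extChartAt_target c).measurableSet
  rw [chartVolume, Measure.map_apply_of_aemeasurable _ hS, withDensity_apply',
    Measure.restrict_restrict' ht]
  exact ((continuousOn_extChartAt_symm c).aemeasurable ht).mono_ac
    (withDensity_absolutelyContinuous _ _)

omit [IsManifold (𝓡 n) ∞ M] [RiemannianBundle (fun x : M ↦ TangentSpace (𝓡 n) x)] in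
theorem measurableSet_preimage_extChartAt_symm (c : M) {S : Set M} (hS : MeasurableSet S) :
    MeasurableSet ((extChartAt (𝓡 n) c).symm ⁻¹' S ∩ (extChartAt (𝓡 n) c).target) := by
  have ht : MeasurableSet (extChartAt (𝓡 n) c).target := (isOpen_extChartAt_target c).measurableSet
  have h := (continuousOn_extChartAt_symm (I := 𝓡 n) c).domRestrict.measurable hS
  rw [Set.inter_comm, ← Subtype.image_preimage_coe]
  exact ht.subtype_image h

/-- The change of variables formula for the transition map produces exactly the Jacobian factor of
`volumeDensity_eq`. -/
theorem chartVolume_eq_of_subset {c c' : M} {S : Set M} (hS : MeasurableSet S)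
    (hc : S ⊆ (extChartAt (𝓡 n) c).source) (hc' : S ⊆ (extChartAt (𝓡 n) c').source) :
    chartVolume (n := n) c S = chartVolume (n := n) c' S := by
  rw [chartVolume_apply c hS, chartVolume_apply c' hS]
  set A := (extChartAt (𝓡 n) c).symm ⁻¹' S ∩ (extChartAt (𝓡 n) c).target with hA
  set A' := (extChartAt (𝓡 n) c').symm ⁻¹' S ∩ (extChartAt (𝓡 n) c').target with hA'
  set f := extChartAt (𝓡 n) c' ∘ (extChartAt (𝓡 n) c).symm with hf
  have hAm : MeasurableSet A := measurableSet_preimage_extChartAt_symm c hS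
  have himg : f '' A = A' := by
    ext z
    constructor
    · rintro ⟨y, ⟨hyS, hyt⟩, rfl⟩
      have h := (extChartAt (𝓡 n) c').map_source (hc' hyS)
      refine ⟨?_, h⟩
      rw [Set.mem_preimage, hf, Function.comp_apply, (extChartAt (𝓡 n) c').left_inv (hc' hyS)]
      exact hyS
    · rintro ⟨hzS, hzt⟩
      have h := (extChartAt (𝓡 n) c).left_inv (hc hzS)
      refine ⟨extChartAt (𝓡 n) c ((extChartAt (𝓡 n) c').symm z), ⟨?_, ?_⟩, ?_⟩
      · rw [Set.mem_preimage, h]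
        exact hzS
      · exact (extChartAt (𝓡 n) c).map_source (hc hzS)
      · rw [hf, Function.comp_apply, h, (extChartAt (𝓡 n) c').right_inv hzt]
  have hinj : Set.InjOn f A := by
    rintro y ⟨hyS, hyt⟩ z ⟨hzS, hzt⟩ hyz
    exact (extChartAt (𝓡 n) c).symm.injOn hyt hzt
      ((extChartAt (𝓡 n) c').injOn (hc' hyS) (hc' hzS) hyz)
  have hd : ∀ y ∈ A, HasFDerivWithinAt f (fderiv ℝ f y) A y := fun y hy ↦
    (volumeDensity_eq hy.2 (hc' hy.1)).1.hasFDerivAt.hasFDerivWithinAt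
  rw [← himg, lintegral_image_eq_lintegral_abs_det_fderiv_mul volume hAm hd hinj]
  refine setLIntegral_congr_fun hAm fun y hy ↦ ?_
  rw [(volumeDensity_eq hy.2 (hc' hy.1)).2, ENNReal.ofReal_mul (abs_nonneg _)]
  rfl

variable [IsContMDiffRiemannianBundle (𝓡 n) ∞ (EuclideanSpace ℝ (Fin n))
      (fun x : M ↦ TangentSpace (𝓡 n) x)]

theorem chartVolume_apply_pos {c : M} {U : Set M} (hU : IsOpen U) (hc : c ∈ U) :
    0 < chartVolume (n := n) c U := by
  rw [chartVolume_apply c hU.measurableSet]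
  set A := (extChartAt (𝓡 n) c).symm ⁻¹' U ∩ (extChartAt (𝓡 n) c).target with hA
  have hAm : MeasurableSet A := measurableSet_preimage_extChartAt_symm c hU.measurableSet
  have hAo : IsOpen A := by
    rw [hA, Set.inter_comm]
    exact (continuousOn_extChartAt_symm c).isOpen_inter_preimage (isOpen_extChartAt_target c) hU
  have hne : A.Nonempty := ⟨extChartAt (𝓡 n) c c, by simpa [hA] using hc⟩
  rw [pos_iff_ne_zero, Ne, lintegral_eq_zero_iff'
    ((((continuousOn_volumeDensity c).mono Set.inter_subset_right).aemeasurable hAm).ennreal_ofReal)]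
  intro h
  -- The density is positive on the nonempty open set `A`; if it vanished almost everywhere there,
  -- `A` would be Lebesgue null.
  have h1 : ∀ᵐ y ∂(volume : Measure (EuclideanSpace ℝ (Fin n))).restrict A, False := by
    filter_upwards [h, ae_restrict_mem hAm] with y hy hyA
    have := volumeDensity_pos hyA.2
    simp only [Pi.zero_apply, ENNReal.ofReal_eq_zero] at hy
    linarith
  rw [Filter.eventually_false_iff_eq_bot, ae_eq_bot, Measure.restrict_eq_zero] at h1
  exact (hAo.measure_pos volume hne).ne' h1

theorem exists_nhds_chartVolume_lt_top (x : M) :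
    ∃ V ∈ nhds x, MeasurableSet V ∧ V ⊆ (extChartAt (𝓡 n) x).source ∧
      chartVolume (n := n) x V < ⊤ := by
  obtain ⟨K, hKx, hKt, hK⟩ := local_compact_nhds
    ((isOpen_extChartAt_target (I := 𝓡 n) x).mem_nhds (mem_extChartAt_target x))
  obtain ⟨C, hC⟩ := hK.exists_bound_of_continuousOn ((continuousOn_volumeDensity x).mono hKt)
  have hVo : IsOpen ((extChartAt (𝓡 n) x).source ∩ extChartAt (𝓡 n) x ⁻¹' interior K) :=
    (continuousOn_extChartAt x).isOpen_inter_preimage (isOpen_extChartAt_source x) isOpen_interior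
  refine ⟨_, hVo.mem_nhds ⟨mem_extChartAt_source x, mem_interior_iff_mem_nhds.2 hKx⟩,
    hVo.measurableSet, Set.inter_subset_left, ?_⟩
  rw [chartVolume_apply x hVo.measurableSet]
  calc _ ≤ ∫⁻ y in K, ENNReal.ofReal (volumeDensity x y) := by
        refine lintegral_mono_set ?_
        rintro y ⟨⟨_, hy⟩, hyt⟩
        rw [Set.mem_preimage, (extChartAt (𝓡 n) x).right_inv hyt] at hy
        exact interior_subset hy
    _ ≤ ∫⁻ y in K, ENNReal.ofReal C := by
        refine setLIntegral_mono' hK.measurableSet fun y hy ↦ ENNReal.ofReal_le_ofReal ?_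
        exact (le_abs_self _).trans (hC y hy)
    _ < ⊤ := by
        rw [setLIntegral_const]
        exact ENNReal.mul_lt_top ENNReal.ofReal_lt_top hK.measure_lt_top

theorem isOpenPosMeasure_riemannianVolume : (riemannianVolume n M).IsOpenPosMeasure where
  open_pos U hU := by
    rintro ⟨c, hc⟩
    have h : chartVolume (n := n) c U ≤ riemannianVolume n M U :=
      le_iSup (fun c : M ↦ chartVolume (n := n) c) c U
    exact ((chartVolume_apply_pos hU hc).trans_le h).ne'

/-- Finitely many chart pieces of finite volume cover `M`. Since chart measures agree on overlaps,
the sum over these pieces dominates every chart measure, hence their supremum. -/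
theorem isFiniteMeasure_riemannianVolume [CompactSpace M] :
    IsFiniteMeasure (riemannianVolume n M) := by
  choose V hV hVm hVs hVt using fun x : M ↦ exists_nhds_chartVolume_lt_top (n := n) x
  obtain ⟨t, -, ht⟩ := isCompact_univ.elim_nhds_subcover V fun x _ ↦ hV x
  let μ : Measure M := ∑ x ∈ t, (chartVolume (n := n) x).restrict (V x)
  have hμ : μ Set.univ < ⊤ := by
    simp only [μ, Measure.coe_finsetSum, Finset.sum_apply, Measure.restrict_apply_univ]
    exact ENNReal.sum_lt_top.2 fun x _ ↦ hVt x
  refine ⟨lt_of_le_of_lt ?_ hμ⟩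
  have hle : riemannianVolume n M ≤ μ := by
    refine iSup_le fun c ↦ Measure.le_iff.2 fun S hS ↦ ?_
    have hcm : MeasurableSet (extChartAt (𝓡 n) c).source := (isOpen_extChartAt_source c).measurableSet
    -- The measure of a chart is carried by its domain; cutting `S` down to it is what allows the
    -- comparison with another chart.
    have hS' : chartVolume (n := n) c S = chartVolume (n := n) c (S ∩ (extChartAt (𝓡 n) c).source) := by
      rw [chartVolume_apply c hS, chartVolume_apply c (hS.inter hcm)]
      congr 2
      ext y
      simp only [Set.mem_inter_iff, Set.mem_preimage]
      exact ⟨fun h ↦ ⟨⟨h.1, (extChartAt (𝓡 n) c).map_target h.2⟩, h.2⟩, fun h ↦ ⟨h.1.1, h.2⟩⟩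
    rw [hS']
    set S' := S ∩ (extChartAt (𝓡 n) c).source with hS'def
    have hS'm : MeasurableSet S' := hS.inter hcm
    calc chartVolume (n := n) c S' ≤ chartVolume (n := n) c (⋃ x ∈ t, S' ∩ V x) := by
          refine measure_mono fun y hy ↦ ?_
          have := ht (Set.mem_univ y)
          simp only [Set.mem_iUnion] at this ⊢
          obtain ⟨x, hx, hyx⟩ := this
          exact ⟨x, hx, hy, hyx⟩
      _ ≤ ∑ x ∈ t, chartVolume (n := n) c (S' ∩ V x) := measure_biUnion_finset_le _ _
      _ = ∑ x ∈ t, chartVolume (n := n) x (S' ∩ V x) := by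
          refine Finset.sum_congr rfl fun x _ ↦ chartVolume_eq_of_subset (hS'm.inter (hVm x)) ?_ ?_
          · exact fun y hy ↦ hy.1.2
          · exact fun y hy ↦ hVs x hy.2
      _ ≤ ∑ x ∈ t, chartVolume (n := n) x (S ∩ V x) := Finset.sum_le_sum fun x _ ↦
          measure_mono (Set.inter_subset_inter_left _ Set.inter_subset_left)
      _ = μ S := by
          simp only [μ, Measure.coe_finsetSum, Finset.sum_apply]
          exact Finset.sum_congr rfl fun x _ ↦ (Measure.restrict_apply hS).symm
  exact hle _

end ChartVolume

/-! ### The functions |∇σ|² and |⟨∇σ, σ⟩|², and the differential of |σ|². -/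

section Sections

variable {n : ℕ} {M : Type*} [TopologicalSpace M] [ChartedSpace (EuclideanSpace ℝ (Fin n)) M]
  [IsManifold (𝓡 n) ∞ M]
  [RiemannianBundle (fun x : M ↦ TangentSpace (𝓡 n) x)]
  {F : Type*} [NormedAddCommGroup F] [NormedSpace ℝ F] [FiniteDimensional ℝ F]
  {E : M → Type*} [TopologicalSpace (TotalSpace F E)]
  [∀ x, NormedAddCommGroup (E x)] [∀ x, InnerProductSpace ℝ (E x)]
  [FiberBundle F E] [VectorBundle ℝ F E] [ContMDiffVectorBundle ∞ F E (𝓡 n)]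
  [IsContMDiffRiemannianBundle (𝓡 n) ∞ F E]

omit [IsManifold (𝓡 n) ∞ M] [RiemannianBundle (fun x : M ↦ TangentSpace (𝓡 n) x)] in
instance finiteDimensional_tangentSpace (x : M) : FiniteDimensional ℝ (TangentSpace (𝓡 n) x) :=
  inferInstanceAs (FiniteDimensional ℝ (EuclideanSpace ℝ (Fin n)))

/-- The squared norm `|∇σ|²` of the covariant derivative of `σ`. -/
def covNormSq (cov : CovariantDerivative (𝓡 n) F E) (σ : Π x : M, E x) (x : M) : ℝ :=
  ∑ i, inner ℝ (cov σ x (stdOrthonormalBasis ℝ (TangentSpace (𝓡 n) x) i))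
    (cov σ x (stdOrthonormalBasis ℝ (TangentSpace (𝓡 n) x) i))

/-- The squared norm of the one-form `⟨∇σ, σ⟩`. -/
def covInnerSq (cov : CovariantDerivative (𝓡 n) F E) (σ : Π x : M, E x) (x : M) : ℝ :=
  ∑ i, inner ℝ (cov σ x (stdOrthonormalBasis ℝ (TangentSpace (𝓡 n) x) i)) (σ x) ^ 2

theorem covInnerSq_nonneg (cov : CovariantDerivative (𝓡 n) F E) (σ : Π x : M, E x) (x : M) :
    0 ≤ covInnerSq cov σ x := Finset.sum_nonneg fun _ _ ↦ sq_nonneg _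

theorem covNormSq_nonneg (cov : CovariantDerivative (𝓡 n) F E) (σ : Π x : M, E x) (x : M) :
    0 ≤ covNormSq cov σ x := Finset.sum_nonneg fun _ _ ↦ real_inner_self_nonneg

/-- Cauchy–Schwarz in each direction. This is the relation B ≤ r A used by `firstVariation_nonneg`.
-/
theorem covInnerSq_le (cov : CovariantDerivative (𝓡 n) F E) (σ : Π x : M, E x) (x : M) :
    covInnerSq cov σ x ≤ ‖σ x‖ ^ 2 * covNormSq cov σ x := by
  rw [covNormSq, Finset.mul_sum]
  refine Finset.sum_le_sum fun i _ ↦ ?_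
  rw [real_inner_self_eq_norm_sq, ← mul_pow, sq_le_sq, abs_of_nonneg (by positivity : 0 ≤ ‖σ x‖ * _),
    mul_comm]
  exact abs_real_inner_le_norm _ _

theorem verticalNormSq_eq (cov : CovariantDerivative (𝓡 n) F E) (p q : ℝ) (σ : Π x : M, E x)
    (x : M) : verticalNormSq cov p q σ x =
      (1 / (1 + ‖σ x‖ ^ 2)) ^ p * (covNormSq cov σ x + q * covInnerSq cov σ x) := by
  simp only [verticalNormSq, verticalMetric, covNormSq, covInnerSq]
  rw [Finset.mul_sum, ← Finset.sum_add_distrib, Finset.mul_sum]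
  exact Finset.sum_congr rfl fun _ _ ↦ by ring

theorem contMDiff_normSq {σ : Π x : M, E x}
    (hσ : ContMDiff (𝓡 n) ((𝓡 n).prod 𝓘(ℝ, F)) ∞ (fun x ↦ (⟨x, σ x⟩ : TotalSpace F E))) :
    ContMDiff (𝓡 n) 𝓘(ℝ, ℝ) ∞ fun x ↦ ‖σ x‖ ^ 2 := by
  simpa only [real_inner_self_eq_norm_sq] using hσ.inner_bundle hσ

section Continuity

variable [IsContMDiffRiemannianBundle (𝓡 n) ∞ (EuclideanSpace ℝ (Fin n))
      (fun x : M ↦ TangentSpace (𝓡 n) x)]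
  (cov : CovariantDerivative (𝓡 n) F E) [cov.ContMDiffCovariantDerivative ∞]
  {σ : Π x : M, E x}
  (hσ : ContMDiff (𝓡 n) ((𝓡 n).prod 𝓘(ℝ, F)) ∞ (fun x ↦ (⟨x, σ x⟩ : TotalSpace F E)))

include hσ

omit [RiemannianBundle (fun x : M ↦ TangentSpace (𝓡 n) x)]
  [IsContMDiffRiemannianBundle (𝓡 n) ∞ (EuclideanSpace ℝ (Fin n))
      (fun x : M ↦ TangentSpace (𝓡 n) x)] in
theorem contMDiffAt_cov_apply {x : M} {X : Π y : M, TangentSpace (𝓡 n) y}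
    (hX : ContMDiffAt (𝓡 n) ((𝓡 n).prod 𝓘(ℝ, EuclideanSpace ℝ (Fin n))) ∞
        (fun y ↦ (⟨y, X y⟩ : TangentBundle (𝓡 n) M)) x) :
    ContMDiffAt (𝓡 n) ((𝓡 n).prod 𝓘(ℝ, F)) ∞
      (fun y ↦ (⟨y, cov σ y (X y)⟩ : TotalSpace F E)) x := by
  have h := (CovariantDerivative.ContMDiffCovariantDerivative.contMDiff (cov := cov)
    (k := ∞)).contMDiff (σ := σ) (by simpa using hσ.contMDiffOn)
  exact ContMDiffAt.clm_bundle_apply (h.contMDiffAt Filter.univ_mem) hX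

theorem continuous_covNormSq : Continuous (covNormSq cov σ) := by
  refine continuous_trace (fun x ↦ stdOrthonormalBasis ℝ (TangentSpace (𝓡 n) x))
    (fun x ↦ (innerₗ (E x)).compl₁₂ (cov σ x).toLinearMap (cov σ x).toLinearMap) ?_
  intro x X Y hX hY
  exact ((contMDiffAt_cov_apply cov hσ hX).inner_bundle
    (contMDiffAt_cov_apply cov hσ hY)).continuousAt

theorem continuous_covInnerSq : Continuous (covInnerSq cov σ) := by
  have h := continuous_trace (fun x ↦ stdOrthonormalBasis ℝ (TangentSpace (𝓡 n) x))
    (fun x ↦ (LinearMap.mul ℝ ℝ).compl₁₂ ((innerₗ (E x) (σ x)) ∘ₗ (cov σ x).toLinearMap)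
      ((innerₗ (E x) (σ x)) ∘ₗ (cov σ x).toLinearMap)) ?_
  · refine h.congr fun x ↦ Finset.sum_congr rfl fun i _ ↦ ?_
    rw [pow_two, real_inner_comm]
    rfl
  intro x X Y hX hY
  exact (((hσ x).inner_bundle (contMDiffAt_cov_apply cov hσ hX)).continuousAt).mul
    (((hσ x).inner_bundle (contMDiffAt_cov_apply cov hσ hY)).continuousAt)

end Continuity

section Derivative

variable {cov : CovariantDerivative (𝓡 n) F E} (hcov : cov.IsMetricCompatible)
  {σ : Π x : M, E x}
  (hσ : ContMDiff (𝓡 n) ((𝓡 n).prod 𝓘(ℝ, F)) ∞ (fun x ↦ (⟨x, σ x⟩ : TotalSpace F E)))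

include hcov hσ

theorem hasMFDerivAt_normSq (x : M) :
    ∃ L : TangentSpace (𝓡 n) x →L[ℝ] ℝ, HasMFDerivAt (𝓡 n) 𝓘(ℝ, ℝ) (fun x ↦ ‖σ x‖ ^ 2) x L ∧
      ∀ v, L v = 2 * inner ℝ (cov σ x v) (σ x) := by
  refine ⟨_, ((contMDiff_normSq hσ).mdifferentiableAt (by simp)).hasMFDerivAt, fun v ↦ ?_⟩
  have hs := (hσ x).mdifferentiableAt (by simp)
  -- The identity is pointwise in the vector field, so any field with value `v` at `x` serves,
  -- smooth or not; here it is constant in the model space.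
  have h := hcov.mvfderiv_inner_eq (fun y : M ↦ (v : EuclideanSpace ℝ (Fin n))) hs hs
  simp only [real_inner_self_eq_norm_sq] at h
  rw [real_inner_comm (cov σ x v) (σ x), ← two_mul] at h
  exact h

theorem hasMFDerivAt_normSq_zero {x : M} (hx : covInnerSq cov σ x = 0) :
    HasMFDerivAt (𝓡 n) 𝓘(ℝ, ℝ) (fun x ↦ ‖σ x‖ ^ 2) x 0 := by
  obtain ⟨L, hL, hLv⟩ := hasMFDerivAt_normSq hcov hσ x
  have h0 : ∀ i, L (stdOrthonormalBasis ℝ (TangentSpace (𝓡 n) x) i) = 0 := fun i ↦ by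
    rw [hLv]
    have := (Finset.sum_eq_zero_iff_of_nonneg (fun _ _ ↦ sq_nonneg _)).1 hx i (Finset.mem_univ _)
    rw [pow_eq_zero_iff two_ne_zero] at this
    rw [this, mul_zero]
  have hL0 : L = 0 := by
    ext v
    rw [← (stdOrthonormalBasis ℝ (TangentSpace (𝓡 n) x)).sum_repr v]
    simp [h0]
  rwa [hL0] at hL

end Derivative

end Sections

/-! ### Rescaling a section by a function of its squared length. -/

section Variation

variable {n : ℕ} {M : Type*} [TopologicalSpace M] [ChartedSpace (EuclideanSpace ℝ (Fin n)) M]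
  [IsManifold (𝓡 n) ∞ M]
  [RiemannianBundle (fun x : M ↦ TangentSpace (𝓡 n) x)]
  {F : Type*} [NormedAddCommGroup F] [NormedSpace ℝ F] [FiniteDimensional ℝ F]
  {E : M → Type*} [TopologicalSpace (TotalSpace F E)]
  [∀ x, NormedAddCommGroup (E x)] [∀ x, InnerProductSpace ℝ (E x)]
  [FiberBundle F E] [VectorBundle ℝ F E] [ContMDiffVectorBundle ∞ F E (𝓡 n)]
  [IsContMDiffRiemannianBundle (𝓡 n) ∞ F E]
  {σ : Π x : M, E x}
  (hσ : ContMDiff (𝓡 n) ((𝓡 n).prod 𝓘(ℝ, F)) ∞ (fun x ↦ (⟨x, σ x⟩ : TotalSpace F E)))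

include hσ

theorem contMDiff_smul_fst {f : M × ℝ → ℝ}
    (hf : ContMDiff ((𝓡 n).prod 𝓘(ℝ, ℝ)) 𝓘(ℝ, ℝ) ∞ f) :
    ContMDiff ((𝓡 n).prod 𝓘(ℝ, ℝ)) ((𝓡 n).prod 𝓘(ℝ, F)) ∞
      (fun z : M × ℝ ↦ (⟨z.1, f z • σ z.1⟩ : TotalSpace F E)) := by
  intro z₀
  rw [contMDiffAt_totalSpace]
  refine ⟨contMDiff_fst z₀, ?_⟩
  have h1 : ContMDiffAt ((𝓡 n).prod 𝓘(ℝ, ℝ)) ((𝓡 n).prod 𝓘(ℝ, F)) ∞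
      (fun z : M × ℝ ↦ (⟨z.1, σ z.1⟩ : TotalSpace F E)) z₀ := (hσ.comp contMDiff_fst) z₀
  rw [contMDiffAt_totalSpace] at h1
  refine ((hf z₀).smul h1.2).congr_of_eventuallyEq ?_
  set e := trivializationAt F E z₀.1
  have he : ∀ᶠ z in nhds z₀, z.1 ∈ e.baseSet := continuousAt_fst.eventually
    (e.open_baseSet.mem_nhds (FiberBundle.mem_baseSet_trivializationAt' z₀.1))
  filter_upwards [he] with z hz
  exact (e.linear ℝ hz).map_smul (f z) (σ z.1)

/-- The variation of `σ` obtained by rescaling `σ` by the function `1 + t φ(|σ|²)`. -/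
theorem isSmoothVariation_rescale {φ : ℝ → ℝ} (hφ : ContDiffOn ℝ ∞ φ (Set.Ioi (-1))) :
    IsSmoothVariation n F σ fun t x ↦ (1 + t * φ (‖σ x‖ ^ 2)) • σ x := by
  refine ⟨contMDiff_smul_fst hσ (f := fun z ↦ 1 + z.2 * φ (‖σ z.1‖ ^ 2)) ?_, by simp⟩
  have h1 : ContMDiff ((𝓡 n).prod 𝓘(ℝ, ℝ)) 𝓘(ℝ, ℝ) ∞ fun z : M × ℝ ↦ φ (‖σ z.1‖ ^ 2) := by
    intro z
    have hr : ‖σ z.1‖ ^ 2 ∈ Set.Ioi (-1 : ℝ) := by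
      simp only [Set.mem_Ioi]
      linarith [sq_nonneg ‖σ z.1‖]
    have h2 := (hφ.contDiffAt (isOpen_Ioi.mem_nhds hr)).contMDiffAt
    exact h2.comp (f := fun z : M × ℝ ↦ ‖σ z.1‖ ^ 2) z
      (((contMDiff_normSq hσ).comp contMDiff_fst) z)
  exact contMDiff_const.add (contMDiff_snd.mul h1)

variable {cov : CovariantDerivative (𝓡 n) F E} (hcov : cov.IsMetricCompatible)

include hcov

/-- Leibniz rule, with d(h(|σ|²)) = 2 h' ⟨∇σ, σ⟩ from metric compatibility. Consequently the
rescaled energy density depends on ∇σ only through |∇σ|² and |⟨∇σ, σ⟩|². -/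
theorem cov_rescale_apply {h : ℝ → ℝ} {h' : ℝ} {x : M} (hh : HasDerivAt h h' (‖σ x‖ ^ 2))
    (v : TangentSpace (𝓡 n) x) :
    cov (fun y ↦ h (‖σ y‖ ^ 2) • σ y) x v =
      h (‖σ x‖ ^ 2) • cov σ x v + (2 * h' * inner ℝ (cov σ x v) (σ x)) • σ x := by
  obtain ⟨L, hL, hLv⟩ := hasMFDerivAt_normSq hcov hσ x
  have h1 : HasMFDerivAt (𝓡 n) 𝓘(ℝ, ℝ) (fun y ↦ h (‖σ y‖ ^ 2)) x
      ((ContinuousLinearMap.toSpanSingleton ℝ h').comp L) :=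
    HasMFDerivAt.comp (I' := 𝓘(ℝ, ℝ)) x (f := fun x ↦ ‖σ x‖ ^ 2) hh.hasFDerivAt.hasMFDerivAt hL
  have h2 := cov.isCovariantDerivativeOnUniv.leibniz ((hσ x).mdifferentiableAt (by simp))
    h1.mdifferentiableAt
  have h3 := congrArg (fun T : TangentSpace (𝓡 n) x →L[ℝ] E x ↦ T v) h2
  have h4 : mvfderiv (𝓡 n) (fun y ↦ h (‖σ y‖ ^ 2)) x v = 2 * h' * inner ℝ (cov σ x v) (σ x) := by
    rw [mvfderiv, h1.mfderiv]
    change (L v) • h' = _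
    rw [hLv, smul_eq_mul]
    ring
  rw [← h4]
  exact h3

theorem covInnerSq_rescale {h : ℝ → ℝ} {h' : ℝ} {x : M} (hh : HasDerivAt h h' (‖σ x‖ ^ 2)) :
    covInnerSq cov (fun y ↦ h (‖σ y‖ ^ 2) • σ y) x =
      (h (‖σ x‖ ^ 2) * (h (‖σ x‖ ^ 2) + 2 * h' * ‖σ x‖ ^ 2)) ^ 2 * covInnerSq cov σ x := by
  simp only [covInnerSq, Finset.mul_sum]
  refine Finset.sum_congr rfl fun i _ ↦ ?_
  rw [cov_rescale_apply hσ hcov hh]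
  simp only [inner_add_left, inner_smul_left, inner_smul_right, real_inner_self_eq_norm_sq,
    conj_trivial]
  ring

theorem covNormSq_rescale {h : ℝ → ℝ} {h' : ℝ} {x : M} (hh : HasDerivAt h h' (‖σ x‖ ^ 2)) :
    covNormSq cov (fun y ↦ h (‖σ y‖ ^ 2) • σ y) x =
      h (‖σ x‖ ^ 2) ^ 2 * covNormSq cov σ x +
        (4 * h (‖σ x‖ ^ 2) * h' + 4 * h' ^ 2 * ‖σ x‖ ^ 2) * covInnerSq cov σ x := by
  simp only [covInnerSq, covNormSq, Finset.mul_sum]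
  rw [← Finset.sum_add_distrib]
  refine Finset.sum_congr rfl fun i _ ↦ ?_
  rw [cov_rescale_apply hσ hcov hh]
  simp only [inner_add_left, inner_add_right, inner_smul_left, inner_smul_right,
    real_inner_self_eq_norm_sq (σ x), conj_trivial]
  rw [real_inner_comm _ (σ x)]
  ring

theorem verticalNormSq_rescale (p q : ℝ) {φ : ℝ → ℝ} {φ' : ℝ} {x : M}
    (hφ : HasDerivAt φ φ' (‖σ x‖ ^ 2)) (t : ℝ) :
    verticalNormSq cov p q (fun y ↦ (1 + t * φ (‖σ y‖ ^ 2)) • σ y) x =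
      (1 + (1 + t * φ (‖σ x‖ ^ 2)) ^ 2 * ‖σ x‖ ^ 2) ^ (-p) *
        ((1 + t * φ (‖σ x‖ ^ 2)) ^ 2 * covNormSq cov σ x +
          (4 * (1 + t * φ (‖σ x‖ ^ 2)) * (t * φ') + 4 * (t * φ') ^ 2 * ‖σ x‖ ^ 2 +
            q * ((1 + t * φ (‖σ x‖ ^ 2)) *
              (1 + t * φ (‖σ x‖ ^ 2) + 2 * (t * φ') * ‖σ x‖ ^ 2)) ^ 2) * covInnerSq cov σ x) := by
  have hh : HasDerivAt (fun s ↦ 1 + t * φ s) (t * φ') (‖σ x‖ ^ 2) :=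
    (hφ.const_mul t).const_add 1
  rw [verticalNormSq_eq, covNormSq_rescale hσ hcov hh, covInnerSq_rescale hσ hcov hh, norm_smul,
    mul_pow, Real.norm_eq_abs, sq_abs, one_div, Real.inv_rpow (by positivity),
    ← Real.rpow_neg (by positivity)]
  ring

end Variation

/-! ### Differentiation under the integral, and the rescaled energy density as a function of t. -/

theorem hasDerivAt_integral_of_continuous {X : Type*} [TopologicalSpace X] [CompactSpace X]
    [MeasurableSpace X] [BorelSpace X] (μ : Measure X) [IsFiniteMeasure μ]
    {f f' : ℝ → X → ℝ} (hf : ∀ t, Continuous (f t))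
    (hf' : Continuous fun z : ℝ × X ↦ f' z.1 z.2)
    (hd : ∀ t x, HasDerivAt (fun s ↦ f s x) (f' t x) t) (t₀ : ℝ) :
    HasDerivAt (fun t ↦ ∫ x, f t x ∂μ) (∫ x, f' t₀ x ∂μ) t₀ := by
  have hint : ∀ g : X → ℝ, Continuous g → Integrable g μ := fun g hg ↦
    hg.integrable_of_hasCompactSupport (HasCompactSupport.of_compactSpace g)
  -- Joint continuity on a compact product gives a constant dominating function, integrable because
  -- `μ` is finite.
  obtain ⟨C, hC⟩ := ((isCompact_closedBall t₀ 1).prod (isCompact_univ (X := X))).exists_bound_of_continuousOn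
    hf'.continuousOn
  refine (hasDerivAt_integral_of_dominated_loc_of_deriv_le (bound := fun _ ↦ C)
    (Metric.closedBall_mem_nhds t₀ one_pos) (Filter.Eventually.of_forall fun t ↦
      (hint _ (hf t)).aestronglyMeasurable) (hint _ (hf t₀))
    (hint (f' t₀) (hf'.comp (Continuous.prodMk_right t₀))).aestronglyMeasurable
    (Filter.Eventually.of_forall fun x t ht ↦ hC (t, x) ⟨ht, Set.mem_univ x⟩)
    (integrable_const C) (Filter.Eventually.of_forall fun x t _ ↦ hd t x)).2

/-- The energy density of the rescaled section `(1 + t φ(|σ|²)) σ` at a point where `|∇σ|² = A`,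
`|⟨∇σ, σ⟩|² = B`, `|σ|² = r`, `φ(r) = a` and `φ'(r) = b`. -/
def rescaledDensity (p q A B r a b t : ℝ) : ℝ :=
  (1 + (1 + t * a) ^ 2 * r) ^ (-p) * ((1 + t * a) ^ 2 * A +
    (4 * (1 + t * a) * (t * b) + 4 * (t * b) ^ 2 * r +
      q * ((1 + t * a) * (1 + t * a + 2 * (t * b) * r)) ^ 2) * B)

/-- The derivative of `rescaledDensity` in `t`. -/
def rescaledDensityDeriv (p q A B r a b t : ℝ) : ℝ :=
  2 * (1 + t * a) * a * r * (-p) * (1 + (1 + t * a) ^ 2 * r) ^ (-p - 1) * ((1 + t * a) ^ 2 * A +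
    (4 * (1 + t * a) * (t * b) + 4 * (t * b) ^ 2 * r +
      q * ((1 + t * a) * (1 + t * a + 2 * (t * b) * r)) ^ 2) * B) +
  (1 + (1 + t * a) ^ 2 * r) ^ (-p) * (2 * (1 + t * a) * a * A +
    (4 * a * (t * b) + 4 * (1 + t * a) * b + 8 * (t * b) * b * r +
      q * (2 * ((1 + t * a) * (1 + t * a + 2 * (t * b) * r)) *
        (a * (1 + t * a + 2 * (t * b) * r) + (1 + t * a) * (a + 2 * b * r)))) * B)

theorem hasDerivAt_rescaledDensity (p q A B a b : ℝ) {r : ℝ} (hr : 0 ≤ r) (t : ℝ) :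
    HasDerivAt (rescaledDensity p q A B r a b) (rescaledDensityDeriv p q A B r a b t) t := by
  have hg : HasDerivAt (fun t : ℝ ↦ 1 + t * a) a t := by
    simpa using ((hasDerivAt_id t).mul_const a).const_add 1
  have hb : HasDerivAt (fun t : ℝ ↦ t * b) b t := by
    simpa using (hasDerivAt_id t).mul_const b
  have hbase : (1 + (1 + t * a) ^ 2 * r) ≠ 0 := by positivity
  have hW := (((hg.pow 2).mul_const r).const_add 1).rpow_const (p := -p) (Or.inl hbase)
  have hu := hg.mul ((hg.add ((hb.const_mul 2).mul_const r)))
  have hQ := ((hg.pow 2).mul_const A).add (((((hg.const_mul 4).mul hb).add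
    (((hb.pow 2).const_mul 4).mul_const r)).add ((hu.pow 2).const_mul q)).mul_const B)
  refine (hW.mul hQ).congr_deriv ?_
  simp only [rescaledDensityDeriv, Pi.add_apply, Pi.mul_apply, Pi.pow_apply]
  push_cast
  ring

theorem continuous_rescaledDensity {X : Type*} [TopologicalSpace X] (p q : ℝ)
    {A B r a b t : X → ℝ} (hA : Continuous A) (hB : Continuous B) (hr : Continuous r)
    (ha : Continuous a) (hb : Continuous b) (ht : Continuous t) (hr0 : ∀ x, 0 ≤ r x) :
    Continuous fun x ↦ rescaledDensity p q (A x) (B x) (r x) (a x) (b x) (t x) := by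
  have hW : Continuous fun x ↦ (1 + (1 + t x * a x) ^ 2 * r x) ^ (-p) := by
    refine Continuous.rpow_const (by fun_prop) fun x ↦ Or.inl ?_
    have := hr0 x
    positivity
  exact hW.mul (by fun_prop)

theorem continuous_rescaledDensityDeriv {X : Type*} [TopologicalSpace X] (p q : ℝ)
    {A B r a b t : X → ℝ} (hA : Continuous A) (hB : Continuous B) (hr : Continuous r)
    (ha : Continuous a) (hb : Continuous b) (ht : Continuous t) (hr0 : ∀ x, 0 ≤ r x) :
    Continuous fun x ↦ rescaledDensityDeriv p q (A x) (B x) (r x) (a x) (b x) (t x) := by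
  have hW : ∀ s : ℝ, Continuous fun x ↦ (1 + (1 + t x * a x) ^ 2 * r x) ^ s := fun s ↦ by
    refine Continuous.rpow_const (by fun_prop) fun x ↦ Or.inl ?_
    have := hr0 x
    positivity
  have h1 := hW (-p)
  have h2 := hW (-p - 1)
  unfold rescaledDensityDeriv
  fun_prop

/-- For φ(r) = (1 + r)^k the bracket would be A (1 - (p-1) r) + B (2k + q (2 + (2 + 2k - p) r)).
Taking k = (p-1)/2 turns the coefficient of qB into 2 + r, positive for every p. -/
theorem rescaledDensityDeriv_zero (p q A B : ℝ) {r : ℝ} (hr : 0 ≤ r) :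
    rescaledDensityDeriv p q A B r ((1 + r) ^ ((p - 1) / 2))
      ((p - 1) / 2 * (1 + r) ^ ((p - 1) / 2 - 1)) 0 =
      2 * (1 + r) ^ (-p - 1 + (p - 1) / 2) *
        (A * (1 - (p - 1) * r) + B * (p - 1 + q * (2 + r))) := by
  have h0 : 0 < 1 + r := by linarith
  have h1 : (1 + r) ^ (-p) = (1 + r) ^ (-p - 1) * (1 + r) := by
    rw [← Real.rpow_add_one h0.ne']
    ring_nf
  have h2 : (1 + r) ^ ((p - 1) / 2) = (1 + r) ^ ((p - 1) / 2 - 1) * (1 + r) := by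
    rw [← Real.rpow_add_one h0.ne']
    ring_nf
  rw [Real.rpow_add h0]
  simp only [rescaledDensityDeriv, zero_mul, add_zero, one_pow, one_mul, mul_zero, mul_one]
  rw [h1, h2]
  ring

/-! ### The integral identity satisfied by harmonic sections. -/

section FirstVariation

variable {n : ℕ} {M : Type*} [TopologicalSpace M] [ChartedSpace (EuclideanSpace ℝ (Fin n)) M]
  [IsManifold (𝓡 n) ∞ M] [CompactSpace M] [MeasurableSpace M] [BorelSpace M]
  [RiemannianBundle (fun x : M ↦ TangentSpace (𝓡 n) x)]
  [IsContMDiffRiemannianBundle (𝓡 n) ∞ (EuclideanSpace ℝ (Fin n))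
      (fun x : M ↦ TangentSpace (𝓡 n) x)]
  {F : Type*} [NormedAddCommGroup F] [NormedSpace ℝ F] [FiniteDimensional ℝ F]
  {E : M → Type*} [TopologicalSpace (TotalSpace F E)]
  [∀ x, NormedAddCommGroup (E x)] [∀ x, InnerProductSpace ℝ (E x)]
  [FiberBundle F E] [VectorBundle ℝ F E] [ContMDiffVectorBundle ∞ F E (𝓡 n)]
  [IsContMDiffRiemannianBundle (𝓡 n) ∞ F E]
  {cov : CovariantDerivative (𝓡 n) F E} [cov.ContMDiffCovariantDerivative ∞]
  (hcov : cov.IsMetricCompatible) {σ : Π x : M, E x}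

/-- The first variation of the energy of `σ` along the rescalings
`(1 + t (1 + |σ|²)^((p - 1) / 2)) σ`. -/
def firstVariationDensity (cov : CovariantDerivative (𝓡 n) F E) (p q : ℝ) (σ : Π x : M, E x)
    (x : M) : ℝ :=
  2 * (1 + ‖σ x‖ ^ 2) ^ (-p - 1 + (p - 1) / 2) *
    (covNormSq cov σ x * (1 - (p - 1) * ‖σ x‖ ^ 2) +
      covInnerSq cov σ x * (p - 1 + q * (2 + ‖σ x‖ ^ 2)))

theorem continuous_firstVariationDensity (p q : ℝ)
    (hσ : ContMDiff (𝓡 n) ((𝓡 n).prod 𝓘(ℝ, F)) ∞ (fun x ↦ (⟨x, σ x⟩ : TotalSpace F E))) :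
    Continuous (firstVariationDensity cov p q σ) := by
  have hA := continuous_covNormSq cov hσ
  have hB := continuous_covInnerSq cov hσ
  have hr := (contMDiff_normSq hσ).continuous
  refine (continuous_const.mul (Continuous.rpow_const (continuous_const.add hr) fun x ↦
    Or.inl ?_)).mul ?_
  · exact (add_pos_of_pos_of_nonneg one_pos (sq_nonneg ‖σ x‖)).ne'
  · fun_prop

-- The derivative of the energy along the rescaling is computed under the integral and also vanishes
-- by harmonicity; uniqueness of derivatives gives the identity.
include hcov in
theorem integral_firstVariationDensity_eq_zero {p q : ℝ} (h : IsHarmonicSection cov p q σ) :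
    ∫ x, firstVariationDensity cov p q σ x ∂(riemannianVolume n M) = 0 := by
  obtain ⟨hσ, hτ⟩ := h
  have := isFiniteMeasure_riemannianVolume (n := n) (M := M)
  have hA := continuous_covNormSq cov hσ
  have hB := continuous_covInnerSq cov hσ
  have hr := (contMDiff_normSq hσ).continuous
  set k : ℝ := (p - 1) / 2 with hk
  have hpow : ∀ s : ℝ, Continuous fun x ↦ (1 + ‖σ x‖ ^ 2) ^ s := fun s ↦
    Continuous.rpow_const (continuous_const.add hr) fun x ↦ Or.inl (by positivity)
  have hφ : ContDiffOn ℝ ∞ (fun s : ℝ ↦ (1 + s) ^ k) (Set.Ioi (-1)) := fun s hs ↦ by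
    have hs' : 1 + s ≠ 0 := by
      rw [Set.mem_Ioi] at hs
      linarith
    exact ((contDiffAt_const.add contDiffAt_id).rpow_const_of_ne hs').contDiffWithinAt
  have hφ' : ∀ x, HasDerivAt (fun s : ℝ ↦ (1 + s) ^ k) (k * (1 + ‖σ x‖ ^ 2) ^ (k - 1))
      (‖σ x‖ ^ 2) := fun x ↦ by
    have h1 := ((hasDerivAt_id (‖σ x‖ ^ 2)).const_add 1).rpow_const (p := k)
      (Or.inl (by simp only [id]; positivity))
    simpa using h1
  let f : ℝ → M → ℝ := fun t x ↦ rescaledDensity p q (covNormSq cov σ x) (covInnerSq cov σ x)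
    (‖σ x‖ ^ 2) ((1 + ‖σ x‖ ^ 2) ^ k) (k * (1 + ‖σ x‖ ^ 2) ^ (k - 1)) t
  let f' : ℝ → M → ℝ := fun t x ↦ rescaledDensityDeriv p q (covNormSq cov σ x)
    (covInnerSq cov σ x) (‖σ x‖ ^ 2) ((1 + ‖σ x‖ ^ 2) ^ k) (k * (1 + ‖σ x‖ ^ 2) ^ (k - 1)) t
  have hd := hasDerivAt_integral_of_continuous (riemannianVolume n M) (f := f) (f' := f')
    (fun t ↦ continuous_rescaledDensity p q hA hB hr (hpow k) (continuous_const.mul (hpow (k - 1)))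
      continuous_const fun x ↦ sq_nonneg _)
    (continuous_rescaledDensityDeriv p q (hA.comp continuous_snd) (hB.comp continuous_snd)
      (hr.comp continuous_snd) ((hpow k).comp continuous_snd)
      (continuous_const.mul ((hpow (k - 1)).comp continuous_snd))
      continuous_fst fun x ↦ sq_nonneg _)
    (fun t x ↦ hasDerivAt_rescaledDensity p q _ _ _ _ (sq_nonneg _) t) 0
  have hE := hτ _ (isSmoothVariation_rescale hσ hφ)
  have hE' := (hd.const_mul (1 / 2)).congr_of_eventuallyEq (f₁ := fun t ↦ verticalEnergy cov p q
    fun x ↦ (1 + t * (1 + ‖σ x‖ ^ 2) ^ k) • σ x) (Filter.Eventually.of_forall fun t ↦ by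
      simp only [verticalEnergy]
      congr 2
      ext1 x
      exact verticalNormSq_rescale hσ hcov p q (hφ' x) t)
  have h0 := hE'.unique hE
  have h1 : ∫ x, f' 0 x ∂(riemannianVolume n M) = 0 := by linarith
  rw [← h1]
  exact integral_congr_ae (Filter.Eventually.of_forall fun x ↦
    (rescaledDensityDeriv_zero p q _ _ (sq_nonneg _)).symm)

end FirstVariation

/-! ### Functions with zero differential, and the pointwise inequality behind the cut-off. -/

theorem exists_forall_eq_of_hasMFDerivAt_zero {n : ℕ} {M : Type*} [TopologicalSpace M]
    [ChartedSpace (EuclideanSpace ℝ (Fin n)) M] [IsManifold (𝓡 n) ∞ M] [ConnectedSpace M]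
    {f : M → ℝ} (hf : ∀ x, HasMFDerivAt (𝓡 n) 𝓘(ℝ, ℝ) f x 0) : ∃ k, ∀ x, f x = k := by
  have hloc : IsLocallyConstant f := by
    rw [IsLocallyConstant.iff_eventually_eq]
    intro x
    obtain ⟨ε, hε, hball⟩ := Metric.mem_nhds_iff.1
      ((isOpen_extChartAt_target (I := 𝓡 n) x).mem_nhds (mem_extChartAt_target x))
    have hd : ∀ y ∈ Metric.ball (extChartAt (𝓡 n) x x) ε,
        HasFDerivAt (f ∘ (extChartAt (𝓡 n) x).symm) (0 : EuclideanSpace ℝ (Fin n) →L[ℝ] ℝ) y := by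
      intro y hy
      have h := (hf ((extChartAt (𝓡 n) x).symm y)).comp y
        (mdifferentiableAt_extChartAt_symm (hball hy)).hasMFDerivAt
      rw [ContinuousLinearMap.zero_comp] at h
      exact h.hasFDerivAt
    have hc : ∀ y ∈ Metric.ball (extChartAt (𝓡 n) x x) ε,
        f ((extChartAt (𝓡 n) x).symm y) = f x := by
      intro y hy
      have h := Metric.isOpen_ball.is_const_of_fderiv_eq_zero
        (convex_ball (extChartAt (𝓡 n) x x) ε).isPreconnected
        (fun z hz ↦ (hd z hz).differentiableAt.differentiableWithinAt)
        (fun z hz ↦ (hd z hz).fderiv) hy (Metric.mem_ball_self hε)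
      simpa only [Function.comp_apply, extChartAt_to_inv] using h
    filter_upwards [(continuousAt_extChartAt (I := 𝓡 n) x).eventually (Metric.ball_mem_nhds _ hε),
      extChartAt_source_mem_nhds (I := 𝓡 n) x] with z hz hzs
    rw [← hc _ hz, (extChartAt (𝓡 n) x).left_inv hzs]
  obtain ⟨x₀⟩ := (inferInstance : Nonempty M)
  exact ⟨f x₀, fun x ↦ hloc.apply_eq_of_isPreconnected isPreconnected_univ (Set.mem_univ x)
    (Set.mem_univ x₀)⟩

/-- For p ≤ 1, B ≤ rA bounds the expression below by A. For 1 < p ≤ 2 both terms are nonnegative and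
the second contains B (p - 1). For p > 2, q may be negative and the bound on r compensates, leaving
at least B/2. -/
theorem firstVariation_nonneg {p q ν A B r : ℝ} (hA : 0 ≤ A) (hB : 0 ≤ B) (hr : 0 ≤ r)
    (hBA : B ≤ r * A)
    (hp : (0 < ν ∧ -4 ≤ p ∧ p ≤ 1) ∨ (1 ≤ ν ∧ 1 < p ∧ r * (ν * (p - 1)) ≤ 1))
    (hq : cutoff ν p ≤ q) :
    0 ≤ A * (1 - (p - 1) * r) + B * (p - 1 + q * (2 + r)) ∧
      (A * (1 - (p - 1) * r) + B * (p - 1 + q * (2 + r)) = 0 → B = 0) := by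
  rcases hp with ⟨-, -, hp⟩ | ⟨hν, hp, hrp⟩
  · have hq0 : 0 ≤ q := by
      refine le_trans ?_ hq
      unfold cutoff
      split_ifs <;> linarith
    have h1 : A ≤ A * (1 - (p - 1) * r) + B * (p - 1 + q * (2 + r)) := by
      have h2 : 0 ≤ (1 - p) * (r * A - B) := mul_nonneg (by linarith) (by linarith)
      have h3 : 0 ≤ B * (q * (2 + r)) := by positivity
      linarith
    refine ⟨hA.trans h1, fun h ↦ ?_⟩
    have hA0 : A = 0 := by linarith
    rw [hA0, mul_zero] at hBA
    linarith
  · have hrp' : (p - 1) * r ≤ 1 := by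
      have : 0 ≤ (ν - 1) * ((p - 1) * r) :=
        mul_nonneg (by linarith) (mul_nonneg (by linarith) hr)
      linarith
    have hA' : 0 ≤ A * (1 - (p - 1) * r) := mul_nonneg hA (by linarith)
    rcases le_or_gt p 2 with hp2 | hp2
    · have hq0 : 0 ≤ q := by
        refine le_trans ?_ hq
        unfold cutoff
        rw [if_neg (by linarith), if_pos hp2]
      have h3 : 0 ≤ B * (q * (2 + r)) := by positivity
      have h4 : 0 ≤ B * (p - 1) := mul_nonneg hB (by linarith)
      refine ⟨by linarith, fun h ↦ ?_⟩
      have h5 : B * (p - 1) = 0 := by linarith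
      rcases mul_eq_zero.1 h5 with h6 | h6
      · exact h6
      · linarith
    · have hq0 : ν * (2 - p) / 2 ≤ q := by
        refine le_trans (le_of_eq ?_) hq
        unfold cutoff
        rw [if_neg (by linarith), if_neg (by linarith)]
      suffices h : B / 2 ≤ A * (1 - (p - 1) * r) + B * (p - 1 + q * (2 + r)) from
        ⟨by linarith, fun h0 ↦ by linarith⟩
      rcases hr.eq_or_lt with rfl | hr0
      · have hB0 : B = 0 := by linarith
        rw [hB0]
        linarith
      -- Multiplying by r lets rA be replaced by B; the terms in p - 1 then cancel, leaving B (1 + q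
      -- r (2 + r)).
      · refine le_of_mul_le_mul_left ?_ hr0
        have h1 : 0 ≤ (r * A - B) * (1 - (p - 1) * r) := mul_nonneg (by linarith) (by linarith)
        -- Since ν(p-1)r ≤ 1, 1 - ν(p-2)r(2+r)/2 is at least νr/2 + νr(1 - (p-2)r)/2, hence at least
        -- νr/2 ≥ r/2.
        have h2 : r / 2 ≤ 1 + q * (r * (2 + r)) := by
          have h3 : ν * (2 - p) / 2 * (r * (2 + r)) ≤ q * (r * (2 + r)) :=
            mul_le_mul_of_nonneg_right hq0 (by positivity)
          have h4 : (p - 2) * r ≤ 1 := by linarith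
          have h5 : r ≤ ν * r := le_mul_of_one_le_left hr hν
          have h6 : 0 ≤ ν * r * (1 - (p - 2) * r) := mul_nonneg (by positivity) (by linarith)
          linarith
        have h7 : B * (r / 2) ≤ B * (1 + q * (r * (2 + r))) := mul_le_mul_of_nonneg_left h2 hB
        linarith

/-! ### Uniqueness of q and the upper bound. -/

section Main

variable {n : ℕ} {M : Type*} [TopologicalSpace M] [ChartedSpace (EuclideanSpace ℝ (Fin n)) M]
  [IsManifold (𝓡 n) ∞ M] [CompactSpace M] [MeasurableSpace M] [BorelSpace M]
  [RiemannianBundle (fun x : M ↦ TangentSpace (𝓡 n) x)]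
  [IsContMDiffRiemannianBundle (𝓡 n) ∞ (EuclideanSpace ℝ (Fin n))
      (fun x : M ↦ TangentSpace (𝓡 n) x)]
  {F : Type*} [NormedAddCommGroup F] [NormedSpace ℝ F] [FiniteDimensional ℝ F]
  {E : M → Type*} [TopologicalSpace (TotalSpace F E)]
  [∀ x, NormedAddCommGroup (E x)] [∀ x, InnerProductSpace ℝ (E x)]
  [FiberBundle F E] [VectorBundle ℝ F E] [ContMDiffVectorBundle ∞ F E (𝓡 n)]
  [IsContMDiffRiemannianBundle (𝓡 n) ∞ F E]

theorem eq_zero_of_integral_riemannianVolume_eq_zero {g : M → ℝ} (hg : Continuous g)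
    (h0 : ∀ x, 0 ≤ g x) (h : ∫ x, g x ∂(riemannianVolume n M) = 0) (x : M) : g x = 0 := by
  have := isFiniteMeasure_riemannianVolume (n := n) (M := M)
  have := isOpenPosMeasure_riemannianVolume (n := n) (M := M)
  by_contra hx
  exact (hg.integral_pos_of_hasCompactSupport_nonneg_nonzero
    (HasCompactSupport.of_compactSpace g) h0 hx).ne' h

theorem exists_covInnerSq_ne_zero [ConnectedSpace M] {cov : CovariantDerivative (𝓡 n) F E}
    (hcov : cov.IsMetricCompatible) {σ : Π x : M, E x}
    (hσ : ContMDiff (𝓡 n) ((𝓡 n).prod 𝓘(ℝ, F)) ∞ (fun x ↦ (⟨x, σ x⟩ : TotalSpace F E)))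
    (hlen : ¬ ∃ k : ℝ, ∀ x, ‖σ x‖ = k) : ∃ x, covInnerSq cov σ x ≠ 0 := by
  by_contra! h
  obtain ⟨k, hk⟩ := exists_forall_eq_of_hasMFDerivAt_zero fun x ↦
    hasMFDerivAt_normSq_zero hcov hσ (h x)
  exact hlen ⟨√k, fun x ↦ by rw [← hk x, Real.sqrt_sq (norm_nonneg _)]⟩

theorem eq_of_isHarmonicSection [ConnectedSpace M] {cov : CovariantDerivative (𝓡 n) F E}
    [cov.ContMDiffCovariantDerivative ∞] (hcov : cov.IsMetricCompatible) {σ : Π x : M, E x}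
    (hlen : ¬ ∃ k : ℝ, ∀ x, ‖σ x‖ = k) {p q r : ℝ}
    (hq : IsHarmonicSection cov p q σ) (hr : IsHarmonicSection cov p r σ) : q = r := by
  have hσ := hq.1
  have := isFiniteMeasure_riemannianVolume (n := n) (M := M)
  obtain ⟨x₀, hx₀⟩ := exists_covInnerSq_ne_zero hcov hσ hlen
  by_contra hne
  have hcont := fun q ↦ continuous_firstVariationDensity (cov := cov) p q hσ
  have hint : ∀ q, Integrable (firstVariationDensity cov p q σ) (riemannianVolume n M) := fun q ↦
    (hcont q).integrable_of_hasCompactSupport (HasCompactSupport.of_compactSpace _)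
  have hdiff : ∀ x, firstVariationDensity cov p q σ x - firstVariationDensity cov p r σ x =
      (q - r) * (2 * (1 + ‖σ x‖ ^ 2) ^ (-p - 1 + (p - 1) / 2) *
        (covInnerSq cov σ x * (2 + ‖σ x‖ ^ 2))) := fun x ↦ by
    unfold firstVariationDensity
    ring
  -- Dividing by q - r makes the integrand nonnegative whichever parameter is larger.
  have h0 : ∫ x, (q - r)⁻¹ * (firstVariationDensity cov p q σ x - firstVariationDensity cov p r σ x)
      ∂(riemannianVolume n M) = 0 := by
    rw [integral_const_mul, integral_sub (hint q) (hint r),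
      integral_firstVariationDensity_eq_zero hcov hq,
      integral_firstVariationDensity_eq_zero hcov hr, sub_zero, mul_zero]
  have hw : ∀ x, 0 < (1 + ‖σ x‖ ^ 2) ^ (-p - 1 + (p - 1) / 2) := fun x ↦
    Real.rpow_pos_of_pos (by positivity) _
  have hval : ∀ x, (q - r)⁻¹ *
      (firstVariationDensity cov p q σ x - firstVariationDensity cov p r σ x) =
      2 * (1 + ‖σ x‖ ^ 2) ^ (-p - 1 + (p - 1) / 2) *
        (covInnerSq cov σ x * (2 + ‖σ x‖ ^ 2)) := fun x ↦ by
    rw [hdiff, inv_mul_cancel_left₀ (sub_ne_zero.2 hne)]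
  have hcont' : Continuous fun x ↦ (q - r)⁻¹ *
      (firstVariationDensity cov p q σ x - firstVariationDensity cov p r σ x) :=
    continuous_const.mul ((hcont q).sub (hcont r))
  have hz := eq_zero_of_integral_riemannianVolume_eq_zero hcont' (fun x ↦ by
      rw [hval]
      have := covInnerSq_nonneg cov σ x
      have := hw x
      positivity) h0 x₀
  rw [hval] at hz
  have := hw x₀
  have h2 : 2 + ‖σ x₀‖ ^ 2 ≠ 0 := by positivity
  simp [this.ne', hx₀, h2] at hz

theorem lt_cutoff_of_isHarmonicSection [ConnectedSpace M] {cov : CovariantDerivative (𝓡 n) F E}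
    [cov.ContMDiffCovariantDerivative ∞] (hcov : cov.IsMetricCompatible) {σ : Π x : M, E x}
    (hlen : ¬ ∃ k : ℝ, ∀ x, ‖σ x‖ = k) {p q ν : ℝ} (hq : IsHarmonicSection cov p q σ)
    (hp : (0 < ν ∧ -4 ≤ p ∧ p ≤ 1) ∨
      (1 ≤ ν ∧ 1 < p ∧ (⨆ x, ‖σ x‖) ^ 2 ≤ 1 / (ν * (p - 1)))) : q < cutoff ν p := by
  have hσ := hq.1
  obtain ⟨x₀, hx₀⟩ := exists_covInnerSq_ne_zero hcov hσ hlen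
  by_contra! hcut
  have hnorm : Continuous fun x ↦ ‖σ x‖ := by
    simpa only [Real.sqrt_sq (norm_nonneg _)] using (contMDiff_normSq hσ).continuous.sqrt
  have hsup : ∀ x, ‖σ x‖ ≤ ⨆ x, ‖σ x‖ := le_ciSup (isCompact_range hnorm).bddAbove
  have hG := fun x ↦ firstVariation_nonneg (p := p) (q := q) (ν := ν) (covNormSq_nonneg cov σ x)
    (covInnerSq_nonneg cov σ x) (sq_nonneg ‖σ x‖) (covInnerSq_le cov σ x)
    (hp.imp_right fun h ↦ ⟨h.1, h.2.1, by
      have hpos : 0 < ν * (p - 1) := mul_pos (by linarith [h.1]) (by linarith [h.2.1])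
      rw [← le_div_iff₀ hpos]
      exact (pow_le_pow_left₀ (norm_nonneg _) (hsup x) 2).trans h.2.2⟩) hcut
  have hw : ∀ x, 0 < 2 * (1 + ‖σ x‖ ^ 2) ^ (-p - 1 + (p - 1) / 2) := fun x ↦
    mul_pos two_pos (Real.rpow_pos_of_pos (by positivity) _)
  have hz := eq_zero_of_integral_riemannianVolume_eq_zero
    (continuous_firstVariationDensity (cov := cov) p q hσ)
    (fun x ↦ mul_nonneg (hw x).le (hG x).1) (integral_firstVariationDensity_eq_zero hcov hq) x₀
  exact hx₀ ((hG x₀).2 ((mul_eq_zero.1 hz).resolve_left (hw x₀).ne'))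

end Main

end PQHarmonic

end

theorem corollary4p9
    {n : ℕ} {M : Type*} [TopologicalSpace M] [ChartedSpace (EuclideanSpace ℝ (Fin n)) M]
    [IsManifold (𝓡 n) ∞ M] [T2Space M] [CompactSpace M] [ConnectedSpace M]
    [MeasurableSpace M] [BorelSpace M]
    -- the Riemannian metric `g` of `M`
    [RiemannianBundle (fun x : M ↦ TangentSpace (𝓡 n) x)]
    [IsContMDiffRiemannianBundle (𝓡 n) ∞ (EuclideanSpace ℝ (Fin n))
      (fun x : M ↦ TangentSpace (𝓡 n) x)]
    -- the smooth vector bundle `E` with its fibre metric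
    {F : Type*} [NormedAddCommGroup F] [NormedSpace ℝ F] [FiniteDimensional ℝ F]
    {E : M → Type*} [TopologicalSpace (TotalSpace F E)]
    [∀ x, NormedAddCommGroup (E x)] [∀ x, InnerProductSpace ℝ (E x)]
    [FiberBundle F E] [VectorBundle ℝ F E] [ContMDiffVectorBundle ∞ F E (𝓡 n)]
    [IsContMDiffRiemannianBundle (𝓡 n) ∞ F E]
    -- the smooth metric connection
    (cov : CovariantDerivative (𝓡 n) F E) [cov.ContMDiffCovariantDerivative ∞]
    (hcov : cov.IsMetricCompatible)
    -- the smooth section, of non-constant length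
    (σ : Π x : M, E x)
    (hσ : ContMDiff (𝓡 n) ((𝓡 n).prod 𝓘(ℝ, F)) ∞ (fun x ↦ (⟨x, σ x⟩ : TotalSpace F E)))
    (hlen : ¬ ∃ k : ℝ, ∀ x, ‖σ x‖ = k) :
    (∀ p q r : ℝ, PQHarmonic.IsHarmonicSection cov p q σ →
      PQHarmonic.IsHarmonicSection cov p r σ → q = r) ∧
    ∀ p q ν : ℝ, PQHarmonic.IsHarmonicSection cov p q σ →
      ((0 < ν ∧ -4 ≤ p ∧ p ≤ 1) ∨
        (1 ≤ ν ∧ 1 < p ∧ (⨆ x, ‖σ x‖) ^ 2 ≤ 1 / (ν * (p - 1)))) →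
      q < PQHarmonic.cutoff ν p :=
  ⟨fun _ _ _ hq hr ↦ PQHarmonic.eq_of_isHarmonicSection hcov hlen hq hr,
    fun _ _ _ hq hp ↦ PQHarmonic.lt_cutoff_of_isHarmonicSection hcov hlen hq hp⟩
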